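/- Let $n$ be an odd positive integer and let $d$ be an invertible element of $\mathbb{Z}/n\mathbb{Z}$. A finite multiset in $\mathbb{Z}/n\mathbb{Z}$ is *balanced* if every element of $\mathbb{Z}/n\mathbb{Z}$ occurs in it with the same multiplicity. For a finite sequence $T=(t_0,\dots,t_{\ell-1})$ let $\partial T=(t_0+t_1,\dots,t_{\ell-2}+t_{\ell-1})$, and for a doubly infinite sequence $S=(a_j)_{j\in\mathbb{Z}}$ let $\partial S=(a_j+a_{j+1})_{j\in\mathbb{Z}}$; the *orbit* of $S$ is the array of the rows $\partial^iS$, $i\ge 0$. Write $S[u,v]=(a_u,a_{u+1},\dots,a_v)$. The following multisets are attached to finite sequences. - For $T$ of length $m\ge1$ and $1\le h\le m$, the *Steinhaus triangle* $\nabla T$ is the multiset union of $T,\partial T,\dots,\partial^{m-1}T$, and the *Steinhaus trapezoid* $ST(T,h)$ is the multiset union of $T,\partial T,\dots,\partial^{h-1}T$. - For $T$ of length $2m-1$, $m\ge1$, and $1\le h\le m$, the *Pascal triangle* $\Delta T$ has the rows $0,\dots,m-1$, its row $i$ consisting of the $i+1$ central terms of $\partial^iT$ (those of indices $m-1-i,\dots,m-1$);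 the *Pascal trapezoid* $PT(T,h)$ is the multiset of the $h$ last rows (rows $m-h,\dots,m-1$) of $\Delta T$; and the *lozenge* $\lozenge T$ is the multiset union of $\Delta T$ and $\nabla\partial^mT$ (the latter being empty if $m=1$). Let $S=(a_j)_{j\in\mathbb{Z}}$ be the sequence $IAP((0,-d,d),(d,-2d,d))$ in $\mathbb{Z}/n\mathbb{Z}$, that is, $a_{3j}=jd$, $a_{3j+1}=-d-2jd$ and $a_{3j+2}=d+jd$ for all $j\in\mathbb{Z}$. Then the following figures, all contained in the orbit of $S$, are balanced: 1. the Steinhaus triangles $\nabla S[m,2m-1]$ for every positive integer $m\equiv0\pmod n$, and $\nabla\partial S[0,m-1]$ for every positive integer $m\equiv-1\pmod{3n}$; 2. the Steinhaus trapezoids $ST(S[m,2m-1],h)$ for all integers $1\le h\le m$ with $m\equiv0\pmod n$ and ($h\equiv0\pmod n$ or $h\equiv m+1\pmod{3n}$), and $ST(\partial S[0,m-1],h)$ for all integers $1\le h\le m$ with $m\equiv-1\pmod{3n}$ and ($h\equiv-1\pmod n$ or $h\equiv0\pmod{3n}$); 3. the Pascal triangles $\Delta\partial S[-m,m-2]$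 for every positive integer $m$ with $m\equiv-1\pmod n$ or $m\equiv0\pmod{3n}$; 4. the Pascal trapezoids $PT(\partial S[-m,m-2],h)$ for all integers $1\le h\le m$ with ($m\equiv-1\pmod n$ or $m\equiv0\pmod{3n}$) and ($h\equiv m+1\pmod n$ or $h\equiv m\pmod{3n}$); 5. the lozenges $\lozenge\partial S[-m,m-2]$ for every positive integer $m\equiv0\pmod n$. Here $\partial S[u,v]$ denotes the segment $(\partial S)[u,v]$ of the sequence $\partial S$. -/

import Mathlib

/-!
Steinhaus figures in `ℤ/nℤ` and interlaced arithmetic progressions.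

Doubly infinite sequences are functions `ℤ → R`; finite sequences are lists.
-/

namespace Steinhaus

/-- The derived sequence `∂S = (a_j + a_{j+1})_{j ∈ ℤ}` of a doubly infinite sequence.
The orbit of `S` consists of the rows `∂^i S = seqDeriv^[i] S`, `i ∈ ℕ`. -/
def seqDeriv {R : Type*} [Add R] (S : ℤ → R) : ℤ → R :=
  fun j => S j + S (j + 1)

/-- The derived sequence `(a_0 + a_1, …, a_{m-2} + a_{m-1})` of a finite sequence
`(a_0, …, a_{m-1})`. -/
def finDeriv {R : Type*} [Add R] (l : List R) : List R :=
  List.zipWith (· + ·) l l.tail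

/-- The finite sequence `S[u, v] = (a_u, a_{u+1}, …, a_v)`, empty when `v < u`. -/
def segment {R : Type*} (S : ℤ → R) (u v : ℤ) : List R :=
  (List.range (v - u + 1).toNat).map fun k : ℕ => S (u + (k : ℤ))

/-- The Steinhaus trapezoid `ST(S, h)`: the multiset union of the `h` first iterated derived
sequences `S, ∂S, …, ∂^{h-1} S` of the finite sequence `S` (here `1 ≤ h ≤ length S`). -/
def steinhausTrapezoid {R : Type*} [Add R] (l : List R) (h : ℕ) : Multiset R :=
  ∑ i ∈ Finset.range h, ((finDeriv^[i] l : List R) : Multiset R)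

/-- The Steinhaus triangle `∇S`: the multiset union of all the iterated derived sequences
`S, ∂S, …, ∂^{m-1} S` of a finite sequence `S` of length `m`. -/
def steinhausTriangle {R : Type*} [Add R] (l : List R) : Multiset R :=
  ∑ i ∈ Finset.range l.length, ((finDeriv^[i] l : List R) : Multiset R)

/-- Row `i` (with `0 ≤ i ≤ m - 1`) of the Pascal triangle associated with a finite sequence `S`
of length `2m - 1`: the `i + 1` terms of `∂^i S` of indices `m - 1 - i, …, m - 1`. It is the
centred part of `∂^i S`, which has length `2m - 1 - i`. -/
def pascalRow {R : Type*} [Add R] (m : ℕ) (l : List R) (i : ℕ) : List R :=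
  ((finDeriv^[i] l).drop (m - 1 - i)).take (i + 1)

/-- The (generalized) Pascal triangle `ΔS` of height `m` associated with a finite sequence `S` of
length `2m - 1`: its top is the central term of `S`. -/
def pascalTriangle {R : Type*} [Add R] (m : ℕ) (l : List R) : Multiset R :=
  ∑ i ∈ Finset.range m, (pascalRow m l i : Multiset R)

/-- The Pascal trapezoid `PT(S, h)`: the `h` last rows (`1 ≤ h ≤ m`) of the Pascal triangle
associated with a finite sequence `S` of length `2m - 1`. -/
def pascalTrapezoid {R : Type*} [Add R] (m : ℕ) (l : List R) (h : ℕ) : Multiset R :=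
  ∑ i ∈ Finset.Ico (m - h) m, (pascalRow m l i : Multiset R)

/-- The lozenge `◇S` associated with a finite sequence `S` of length `2m - 1`: the multiset union
of `ΔS` and of `∇∂^m S`. -/
def lozenge {R : Type*} [Add R] (m : ℕ) (l : List R) : Multiset R :=
  pascalTriangle m l + steinhausTriangle (finDeriv^[m] l)

/-- A finite multiset in `ℤ/nℤ` is balanced if all the elements of `ℤ/nℤ` have the same
multiplicity in it. -/
def IsBalanced {n : ℕ} (M : Multiset (ZMod n)) : Prop :=
  ∀ x y : ZMod n, M.count x = M.count y

/-- The `k`-interlaced arithmetic progression `IAP(A, D)`: `a_{j₀ + jk} = A_{j₀} + j D_{j₀}` for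
all `0 ≤ j₀ ≤ k - 1` and `j ∈ ℤ`. -/
def IAP {R : Type*} [AddCommGroup R] {k : ℕ} [NeZero k] (A D : Fin k → R) : ℤ → R :=
  fun j => A (Fin.ofNat k (j % k).toNat) + (j / k) • D (Fin.ofNat k (j % k).toNat)

/-- The universal sequence `IAP((0, -d, d), (d, -2d, d))` in `ℤ/nℤ`. -/
def universalSeq {n : ℕ} (d : ZMod n) : ℤ → ZMod n :=
  IAP ![0, -d, d] ![d, -2 * d, d]

/-- The defining property of interlaced arithmetic progressions. -/
theorem IAP_apply {R : Type*} [AddCommGroup R] {k : ℕ} [NeZero k] (A D : Fin k → R)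
    (j₀ : Fin k) (j : ℤ) : IAP A D ((j₀ : ℤ) + j * k) = A j₀ + j • D j₀ := by
  have hk : (0 : ℤ) < k := by exact_mod_cast Nat.pos_of_ne_zero (NeZero.ne k)
  have h0 : (0 : ℤ) ≤ (j₀ : ℤ) := by positivity
  have h1 : (j₀ : ℤ) < k := by exact_mod_cast j₀.isLt
  have hm : ((j₀ : ℤ) + j * k) % k = j₀ := by
    rw [Int.add_mul_emod_self_right, Int.emod_eq_of_lt h0 h1]
  have hd : ((j₀ : ℤ) + j * k) / k = j := by
    rw [Int.add_mul_ediv_right _ _ hk.ne', Int.ediv_eq_zero_of_lt h0 h1, zero_add]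
  have hf : Fin.ofNat k ((j₀ : ℤ)).toNat = j₀ := by
    ext
    simp [Fin.ofNat, Nat.mod_eq_of_lt j₀.isLt]
  simp only [IAP, hm, hd, hf]

/-- The figures associated with `S[u, v]` are contained in the orbit of `S`: the iterated derived
sequences of `S[u, v]` are segments of the rows of that orbit. -/
theorem finDeriv_iterate_segment {R : Type*} [Add R] (S : ℤ → R) (u v : ℤ) (i : ℕ) :
    finDeriv^[i] (segment S u v) = segment (seqDeriv^[i] S) u (v - i) := by
  have key : ∀ (T : ℤ → R) (w : ℤ),
      finDeriv (segment T u w) = segment (seqDeriv T) u (w - 1) := by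
    intro T w
    apply List.ext_getElem
    · simp only [finDeriv, segment, List.length_zipWith, List.length_tail, List.length_map,
        List.length_range]
      omega
    · intro p h1 h2
      simp only [finDeriv, segment, seqDeriv, List.getElem_zipWith, List.getElem_tail,
        List.getElem_map, List.getElem_range]
      push_cast
      rw [add_assoc]
  induction i with
  | zero => simp
  | succ i ih =>
    rw [Function.iterate_succ_apply', ih, key, Function.iterate_succ_apply']
    congr 1
    push_cast
    ring

end Steinhaus

/-! Up to the sign `(-1) ^ i`, every orbit entry is an integer multiple of `d`: its coefficient is
one third of the only multiple of 3 among three linear forms in `i, j` with sum zero (`orbit_eq`).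
Modulo `n`, the figures consist of rows whose coefficients depend only on the length `t + 1` and on
the family `e`. Such rows are symmetric under negation, so the sign drops out. Trapezoids become
differences of two triangles of one family, and only `triCount` remains to be studied.

The multiplicity of an integer `v` in the first `k` rows is explicit: flat up to parity for `3|v| ≤
k`, then linearly decreasing to 0. Folded modulo `k` (`e = 1`) or `k + 1` (`e = 2`), the slopes
cancel, leaving a constant plus, for an even modulus, a correction on odd `v`. As `n` is odd, both
parts are balanced progressions (`isConst_of_fold`). The classes modulo `3n` come from removing or
adding one row of length `3L` with `n ∣ L`, itself balanced (`isConst_rowCount`). For lozenges, one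
row is exchanged between the two families (`isConst_triCount_add`). -/

namespace Steinhaus

/-! ### Constant counting functions and arithmetic progressions -/

/-- A function on `ZMod n` is constant. -/
def IsConst {n : ℕ} (G : ZMod n → ℤ) : Prop := ∀ x y, G x = G y

/-- The indicator of `x = w`. -/
def ind {n : ℕ} (w x : ZMod n) : ℤ := if x = w then 1 else 0

lemma isConst_of_add_unit {n : ℕ} [NeZero n] {G : ZMod n → ℤ} {e : ZMod n} (he : IsUnit e)
    (h : ∀ w, G (w + e) = G w) : IsConst G := by
  have key : ∀ (c : ℕ) (w : ZMod n), G (w + c * e) = G w := by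
    intro c
    induction c with
    | zero => simp
    | succ c ih =>
      intro w
      rw [← ih w, ← h (w + c * e)]
      congr 1
      push_cast
      ring
  intro x y
  obtain ⟨u, rfl⟩ := he
  rw [← key ((x - y) * ((u⁻¹ : (ZMod n)ˣ) : ZMod n)).val y]
  congr 1
  rw [ZMod.natCast_zmod_val, mul_assoc, Units.inv_mul]
  ring

/-- Arithmetic progressions whose length is a multiple of `n` and whose common difference is
invertible are balanced. -/
lemma isConst_arith {n : ℕ} [NeZero n] {e : ZMod n} (he : IsUnit e) (b : ZMod n) {L : ℕ}
    (hL : n ∣ L) : IsConst fun w : ZMod n => ∑ a ∈ Finset.range L, ind w (b + a * e) := by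
  refine isConst_of_add_unit he fun w => ?_
  -- Splitting off the last or the first of `L + 1` terms gives the sum at `w + e` or its translate
  -- at `w`; the two end terms agree because `L * e = 0`.
  have h1 := Finset.sum_range_succ (fun a : ℕ => ind (w + e) (b + a * e)) L
  rw [Finset.sum_range_succ'] at h1
  have h0 : (L : ZMod n) = 0 := (ZMod.natCast_eq_zero_iff _ _).2 hL
  have h2 : ∀ a : ℕ, ind (w + e) (b + ((a + 1 : ℕ) : ZMod n) * e) = ind w (b + a * e) := by
    intro a
    unfold ind
    congr 1
    rw [← add_left_inj e (b := b + a * e)]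
    push_cast
    rw [add_mul, one_mul, add_assoc]
  simp only [h2, h0, Nat.cast_zero] at h1
  linarith

lemma IsConst.add {n : ℕ} {F G : ZMod n → ℤ} (hF : IsConst F) (hG : IsConst G) :
    IsConst fun w => F w + G w := fun x y => by
  have h1 := hF x y
  have h2 := hG x y
  simp only [h1, h2]

lemma IsConst.sub {n : ℕ} {F G : ZMod n → ℤ} (hF : IsConst F) (hG : IsConst G) :
    IsConst fun w => F w - G w := fun x y => by
  have h1 := hF x y
  have h2 := hG x y
  simp only [h1, h2]

lemma IsConst.const_mul {n : ℕ} {F : ZMod n → ℤ} (hF : IsConst F) (c : ℤ) :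
    IsConst fun w => c * F w := fun x y => by
  have h1 := hF x y
  simp only [h1]

lemma count_coe_map_range {n : ℕ} (w : ZMod n) (f : ℕ → ZMod n) (L : ℕ) :
    (((((List.range L).map f : List (ZMod n)) : Multiset (ZMod n)).count w : ℕ) : ℤ)
      = ∑ a ∈ Finset.range L, ind w (f a) := by
  induction L with
  | zero => simp
  | succ L ih =>
    rw [Finset.sum_range_succ, ← ih, List.range_succ]
    simp only [Multiset.coe_count, List.map_append, List.count_append, List.map_cons,
      List.map_nil, List.count_singleton, ind, beq_iff_eq]
    push_cast
    rfl

lemma count_segment {n : ℕ} (w : ZMod n) (T : ℤ → ZMod n) (u v : ℤ) :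
    ((((segment T u v : List (ZMod n)) : Multiset (ZMod n)).count w : ℕ) : ℤ)
      = ∑ a ∈ Finset.range (v - u + 1).toNat, ind w (T (u + a)) :=
  count_coe_map_range w _ _

lemma isBalanced_of_count {n : ℕ} {M : Multiset (ZMod n)} {G : ZMod n → ℤ} (hG : IsConst G)
    (h : ∀ w, ((M.count w : ℕ) : ℤ) = G w) : IsBalanced M := fun x y => by
  have : ((M.count x : ℕ) : ℤ) = (M.count y : ℕ) := by rw [h, h, hG x y]
  exact_mod_cast this

/-! ### Integer coefficients of the orbit -/

/-- The coefficients of the orbit of the universal sequence, up to sign. -/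
def orbitCoeff (i j : ℤ) : ℤ :=
  if 3 ∣ j - i then (j - i) / 3
  else if 3 ∣ i + 2 * j + 1 then -((i + 2 * j + 1) / 3)
  else (2 * i + j + 1) / 3

/-- The three forms are pairwise incongruent modulo 3, so only one alternative is possible and this
disjunction pins down the coefficient in a form suited to `omega`. -/
lemma orbitCoeff_spec (i j : ℤ) : 3 * orbitCoeff i j = j - i ∨
    3 * orbitCoeff i j = -(i + 2 * j + 1) ∨ 3 * orbitCoeff i j = 2 * i + j + 1 := by
  unfold orbitCoeff
  split_ifs with h1 h2
  · left; omega
  · right; left; omega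
  · right; right
    obtain hr | hr | hr : (j - i) % 3 = 0 ∨ (j - i) % 3 = 1 ∨ (j - i) % 3 = 2 := by omega
    · omega
    · omega
    · have : (3 : ℤ) ∣ 2 * i + j + 1 := ⟨i + (j - i) / 3 + 1, by omega⟩
      omega

/-- The three cells involved select three different forms; these sum to zero, and so do their
increments between the cells. -/
lemma orbitCoeff_succ (i j : ℤ) :
    orbitCoeff (i + 1) j = -(orbitCoeff i j + orbitCoeff i (j + 1)) := by
  have h1 := orbitCoeff_spec i j
  have h2 := orbitCoeff_spec i (j + 1)
  have h3 := orbitCoeff_spec (i + 1) j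
  rcases h1 with h1 | h1 | h1 <;> rcases h2 with h2 | h2 | h2 <;> rcases h3 with h3 | h3 | h3 <;>
    omega

lemma universalSeq_eq {n : ℕ} (d : ZMod n) (j : ℤ) :
    universalSeq d j = (orbitCoeff 0 j : ZMod n) * d := by
  have h0 := IAP_apply ![0, -d, d] ![d, -2 * d, d] 0 (j / 3)
  have h1 := IAP_apply ![0, -d, d] ![d, -2 * d, d] 1 (j / 3)
  have h2 := IAP_apply ![0, -d, d] ![d, -2 * d, d] 2 (j / 3)
  have hs := orbitCoeff_spec 0 j
  unfold universalSeq
  obtain hj | hj | hj : j % 3 = 0 ∨ j % 3 = 1 ∨ j % 3 = 2 := by omega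
  · rw [show (((0 : Fin 3) : ℕ) : ℤ) + j / 3 * (3 : ℕ) = j by simp; omega] at h0
    rw [h0, show orbitCoeff 0 j = j / 3 by omega]
    simp
  · rw [show (((1 : Fin 3) : ℕ) : ℤ) + j / 3 * (3 : ℕ) = j by simp; omega] at h1
    rw [h1, show orbitCoeff 0 j = -1 - 2 * (j / 3) by omega]
    simp
    ring
  · rw [show (((2 : Fin 3) : ℕ) : ℤ) + j / 3 * (3 : ℕ) = j by simp; omega] at h2
    rw [h2, show orbitCoeff 0 j = 1 + j / 3 by omega]
    simp
    ring

/-- Closed form for the orbit of the universal sequence. -/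
lemma orbit_eq {n : ℕ} (d : ZMod n) (i : ℕ) (j : ℤ) :
    seqDeriv^[i] (universalSeq d) j = (-1) ^ i * ((orbitCoeff i j : ZMod n) * d) := by
  induction i generalizing j with
  | zero => simp [universalSeq_eq]
  | succ i ih =>
    rw [Function.iterate_succ_apply', seqDeriv, ih, ih]
    push_cast
    rw [orbitCoeff_succ]
    push_cast
    ring

/-! ### Rows of the two families of triangles -/

/-- The coefficients of the two families of triangles (`e = 1` for Steinhaus triangles, `e = 2`
for Pascal triangles): the term of index `s` in the row of length `t + 1`. -/
def triCoeff (e t s : ℤ) : ℤ :=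
  if 3 ∣ s + t + e then (s + t + e) / 3
  else if 3 ∣ t - 2 * s then (t - 2 * s) / 3
  else -((2 * t - s + e) / 3)

lemma triCoeff_spec {e : ℤ} (he : e = 1 ∨ e = 2) (t s : ℤ) : 3 * triCoeff e t s = s + t + e ∨
    3 * triCoeff e t s = t - 2 * s ∨ 3 * triCoeff e t s = -(2 * t - s + e) := by
  unfold triCoeff
  split_ifs with h1 h2
  · left; omega
  · right; left; omega
  · right; right
    obtain hr | hr | hr : (s + t) % 3 = 0 ∨ (s + t) % 3 = 1 ∨ (s + t) % 3 = 2 := by omega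
    · omega
    · have : (3 : ℤ) ∣ 2 * t - s + e := by
        rcases he with rfl | rfl
        · exact ⟨t - (s + t) / 3, by omega⟩
        · omega
      omega
    · have : (3 : ℤ) ∣ 2 * t - s + e := by
        rcases he with rfl | rfl
        · omega
        · exact ⟨t - (s + t) / 3, by omega⟩
      omega

/-- Reversing the row swaps the first and third forms up to sign and negates the second. Hence
negating a row only permutes it. -/
lemma triCoeff_reflect {e : ℤ} (he : e = 1 ∨ e = 2) (t s : ℤ) :
    triCoeff e t (t - s) = -triCoeff e t s := by
  have h1 := triCoeff_spec he t s
  have h2 := triCoeff_spec he t (t - s)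
  rcases h1 with h1 | h1 | h1 <;> rcases h2 with h2 | h2 | h2 <;> rcases he with rfl | rfl <;>
    omega

/-- The number of occurrences of `w` in the row of length `t + 1`. -/
def rowCount {n : ℕ} (d : ZMod n) (e : ℤ) (t : ℕ) (w : ZMod n) : ℤ :=
  ∑ s ∈ Finset.range (t + 1), ind w ((triCoeff e t s : ZMod n) * d)

lemma rowCount_eq_of_sign {n : ℕ} (d : ZMod n) {e : ℤ} (he : e = 1 ∨ e = 2) (t : ℕ) (w : ZMod n)
    (i : ℕ) : ∑ s ∈ Finset.range (t + 1), ind w ((-1) ^ i * ((triCoeff e t s : ZMod n) * d))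
      = rowCount d e t w := by
  rcases Nat.even_or_odd i with hi | hi
  · simp [hi.neg_one_pow, rowCount]
  · rw [rowCount, ← Finset.sum_range_reflect]
    refine Finset.sum_congr rfl fun s hs => ?_
    have hs' : s ≤ t := by
      have := Finset.mem_range.1 hs
      omega
    have : ((t + 1 - 1 - s : ℕ) : ℤ) = t - s := by omega
    rw [this, triCoeff_reflect he, hi.neg_one_pow]
    push_cast
    ring_nf

/-- A segment of the orbit whose coefficients are, modulo `n`, those of a row of a triangle. -/
lemma count_segment_orbit {n : ℕ} (d : ZMod n) {e : ℤ} (he : e = 1 ∨ e = 2) (t i : ℕ) (u v : ℤ)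
    (huv : v - u = t) (M : ℤ) (hM : (n : ℤ) ∣ M)
    (h : ∀ s : ℕ, s ≤ t → ∃ c, orbitCoeff i (u + s) = triCoeff e t s + c * M) (w : ZMod n) :
    ((((segment (seqDeriv^[i] (universalSeq d)) u v : List (ZMod n)) :
      Multiset (ZMod n)).count w : ℕ) : ℤ) = rowCount d e t w := by
  rw [count_segment, ← rowCount_eq_of_sign d he t w i]
  have : (v - u + 1).toNat = t + 1 := by omega
  rw [this]
  refine Finset.sum_congr rfl fun s hs => ?_
  obtain ⟨c, hc⟩ := h s (by have := Finset.mem_range.1 hs; omega)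
  have hM0 : (M : ZMod n) = 0 := (ZMod.intCast_zmod_eq_zero_iff_dvd _ _).2 hM
  rw [orbit_eq, hc]
  push_cast
  rw [hM0]
  simp

/-! ### Multiplicities of integers in rows and triangles -/

/-- The multiplicity of the integer `v` in the row of length `t + 1`. -/
def rowMult (e : ℤ) (t : ℕ) (v : ℤ) : ℤ :=
  (if t + e ≤ 3 * |v| ∧ 3 * |v| ≤ 2 * t + e then 1 else 0) +
    (if 3 * |v| ≤ t ∧ 2 ∣ v - t then 1 else 0)

lemma sum_ite_eq_ite {N : ℕ} {P : ℕ → Prop} [DecidablePred P] {Q : Prop} [Decidable Q]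
    (h0 : ∀ s < N, P s → Q) (h1 : Q → ∃ s < N, ∀ r, P r ↔ r = s) :
    ∑ s ∈ Finset.range N, (if P s then (1 : ℤ) else 0) = if Q then 1 else 0 := by
  split_ifs with hQ
  · obtain ⟨s, hs, h⟩ := h1 hQ
    simp only [h]
    rw [Finset.sum_ite_eq', if_pos (Finset.mem_range.2 hs)]
  · exact Finset.sum_eq_zero fun s hs => if_neg fun hP => hQ (h0 s (Finset.mem_range.1 hs) hP)

/-- Each form takes a given value at most once along the row. The outer forms cover positive and
negative `v` symmetrically, whence `|v|`; the middle one needs `3v ≡ t` modulo 2, that is `v ≡ t`.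
-/
lemma card_triCoeff_fiber {e : ℤ} (he : e = 1 ∨ e = 2) (t : ℕ) (v : ℤ) :
    ∑ s ∈ Finset.range (t + 1), (if triCoeff e t s = v then (1 : ℤ) else 0) = rowMult e t v := by
  have h1 : ∀ s : ℕ, (if triCoeff e t s = v then (1 : ℤ) else 0) =
      (if 3 * v = s + t + e then 1 else 0) + (if 3 * v = t - 2 * s then 1 else 0) +
      (if 3 * v = -(2 * t - s + e) then 1 else 0) := by
    intro s
    have h2 := triCoeff_spec he t s
    rcases he with rfl | rfl <;> rcases h2 with h2 | h2 | h2 <;> split_ifs <;> omega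
  have e1 : ∑ s ∈ Finset.range (t + 1), (if 3 * v = s + t + e then (1 : ℤ) else 0) =
      if t + e ≤ 3 * v ∧ 3 * v ≤ 2 * t + e then 1 else 0 :=
    sum_ite_eq_ite (fun s hs h => by omega) fun h =>
      ⟨(3 * v - t - e).toNat, by omega, fun r => by omega⟩
  have e2 : ∑ s ∈ Finset.range (t + 1), (if 3 * v = t - 2 * s then (1 : ℤ) else 0) =
      if 3 * |v| ≤ t ∧ 2 ∣ v - t then 1 else 0 := by
    rcases abs_cases v with ⟨hv, _⟩ | ⟨hv, _⟩ <;> rw [hv] <;>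
    exact sum_ite_eq_ite (fun s hs h => by omega) fun h =>
      ⟨((t - 3 * v) / 2).toNat, by omega, fun r => by omega⟩
  have e3 : ∑ s ∈ Finset.range (t + 1), (if 3 * v = -(2 * t - s + e) then (1 : ℤ) else 0) =
      if t + e ≤ -(3 * v) ∧ -(3 * v) ≤ 2 * t + e then 1 else 0 :=
    sum_ite_eq_ite (fun s hs h => by omega) fun h =>
      ⟨(2 * t + e + 3 * v).toNat, by omega, fun r => by omega⟩
  simp only [h1, Finset.sum_add_distrib, e1, e2, e3]
  unfold rowMult
  rw [add_right_comm]
  congr 1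
  rcases abs_cases v with ⟨hv, _⟩ | ⟨hv, _⟩ <;> rw [hv] <;> split_ifs <;> omega

lemma abs_triCoeff_le {e : ℤ} (he : e = 1 ∨ e = 2) (t s : ℕ) (hs : s ≤ t) :
    3 * |triCoeff e t s| ≤ 2 * t + e := by
  have h := triCoeff_spec he t s
  rcases abs_cases (triCoeff e t s) with ⟨hv, _⟩ | ⟨hv, _⟩ <;> rw [hv] <;> omega

lemma rowCount_eq_sum_rowMult {n : ℕ} (d : ZMod n) {e : ℤ} (he : e = 1 ∨ e = 2) (t K : ℕ)
    (hK : 2 * t + e < 3 * K) (w : ZMod n) :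
    rowCount d e t w = ∑ v ∈ Finset.Ico (-K : ℤ) K, rowMult e t v * ind w (v * d) := by
  simp only [← card_triCoeff_fiber he, Finset.sum_mul]
  rw [Finset.sum_comm, rowCount]
  refine Finset.sum_congr rfl fun s hs => ?_
  have h1 := abs_triCoeff_le he t s (by have := Finset.mem_range.1 hs; omega)
  have h2 : triCoeff e t s ∈ Finset.Ico (-K : ℤ) K := by
    rw [Finset.mem_Ico]
    have := abs_le.1 (le_refl |triCoeff e t s|)
    omega
  simp only [ite_mul, one_mul, zero_mul]
  rw [Finset.sum_ite_eq, if_pos h2]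

/-- The number of occurrences of `w` in the first `k` rows. -/
def triCount {n : ℕ} (d : ZMod n) (e : ℤ) (k : ℕ) (w : ZMod n) : ℤ :=
  ∑ t ∈ Finset.range k, rowCount d e t w

/-- The multiplicity of the integer `v` in the first `k` rows. -/
def triMult (e : ℤ) (k : ℕ) (v : ℤ) : ℤ :=
  max 0 (min (3 * |v| + 1 - e) k - (3 * |v| + e - 1) / 2 + (e - 1)) +
    max 0 ((k + 1 - 3 * |v|) / 2)

/-- The first maximum in `triMult` counts the `t < k` with `(3|v| - e) / 2 ≤ t ≤ 3|v| - e`; the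
second counts `t = 3|v|, 3|v| + 2, …` below `k`. -/
lemma sum_rowMult {e : ℤ} (he : e = 1 ∨ e = 2) (k : ℕ) (v : ℤ) :
    ∑ t ∈ Finset.range k, rowMult e t v = triMult e k v := by
  have h0 := abs_nonneg v
  have hp : (2 : ℤ) ∣ v ↔ (2 : ℤ) ∣ |v| := (dvd_abs 2 v).symm
  induction k with
  | zero =>
    rw [Finset.sum_range_zero]
    unfold triMult
    rcases he with rfl | rfl <;> omega
  | succ k ih =>
    rw [Finset.sum_range_succ, ih]
    unfold triMult rowMult
    push_cast
    rcases he with rfl | rfl <;> split_ifs <;> omega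

lemma triCount_eq_sum_triMult {n : ℕ} (d : ZMod n) {e : ℤ} (he : e = 1 ∨ e = 2) (k K : ℕ)
    (hK : 2 * k + e < 3 * K + 2) (w : ZMod n) :
    triCount d e k w = ∑ v ∈ Finset.Ico (-K : ℤ) K, triMult e k v * ind w (v * d) := by
  simp only [← sum_rowMult he, Finset.sum_mul]
  rw [Finset.sum_comm, triCount]
  refine Finset.sum_congr rfl fun t ht => rowCount_eq_sum_rowMult d he t K ?_ w
  have := Finset.mem_range.1 ht
  omega

/-! ### Folding weights modulo `K` -/

lemma sum_Ico_neg_eq (K : ℕ) (f : ℤ → ℤ) :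
    ∑ v ∈ Finset.Ico (-K : ℤ) K, f v = ∑ a ∈ Finset.range K, (f a + f (a - K)) := by
  rw [show Finset.Ico (-K : ℤ) K = Finset.Ico (-K : ℤ) 0 ∪ Finset.Ico 0 K by
      ext; simp only [Finset.mem_union, Finset.mem_Ico]; omega,
    Finset.sum_union (Finset.disjoint_left.2 fun x hx hy => by
      rw [Finset.mem_Ico] at hx hy; omega), Finset.sum_add_distrib, add_comm]
  congr 1
  · refine (Finset.sum_nbij' (fun a : ℕ => (a : ℤ)) Int.toNat ?_ ?_ ?_ ?_ ?_).symm <;>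
      simp <;> omega
  · refine (Finset.sum_nbij' (fun a : ℕ => (a : ℤ) - K) (fun v => (v + K).toNat) ?_ ?_ ?_ ?_ ?_).symm
      <;> simp <;> omega

lemma sum_range_two_mul (L : ℕ) (f : ℕ → ℤ) :
    ∑ a ∈ Finset.range (2 * L), f a = ∑ b ∈ Finset.range L, (f (2 * b) + f (2 * b + 1)) := by
  induction L with
  | zero => simp
  | succ L ih =>
    rw [Finset.sum_range_succ, ← ih, mul_add_one, Finset.sum_range_succ, Finset.sum_range_succ]
    ring

lemma sum_range_three_mul (L : ℕ) (f : ℕ → ℤ) :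
    ∑ a ∈ Finset.range (3 * L), f a
      = ∑ b ∈ Finset.range L, (f (3 * b) + f (3 * b + 1) + f (3 * b + 2)) := by
  induction L with
  | zero => simp
  | succ L ih =>
    rw [Finset.sum_range_succ, ← ih, mul_add_one, Finset.sum_range_succ, Finset.sum_range_succ,
      Finset.sum_range_succ]
    ring

lemma isUnit_two_mul {n : ℕ} (hn : Odd n) {d : ZMod n} (hd : IsUnit d) : IsUnit (2 * d) := by
  have : IsUnit ((2 : ℕ) : ZMod n) :=
    (ZMod.isUnit_iff_coprime 2 n).2 (Nat.coprime_two_left.2 hn)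
  exact IsUnit.mul (by exact_mod_cast this) hd

/-- A weight on `[-K, K)` whose folding modulo `K` is constant, up to the parity of the argument
when `K` is even, is balanced modulo every odd divisor of `K`. -/
lemma isConst_of_fold {n : ℕ} (hn : Odd n) {d : ZMod n} (hd : IsUnit d) {K : ℕ} (hK : n ∣ K)
    (F : ℤ → ℤ) (c σ : ℤ)
    (hF : ∀ v : ℤ, 0 ≤ v → v < K → F v + F (v - K) = c + if 2 ∣ K ∧ ¬ 2 ∣ v then σ else 0) :
    IsConst fun w : ZMod n => ∑ v ∈ Finset.Ico (-K : ℤ) K, F v * ind w (v * d) := by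
  have : NeZero n := ⟨hn.pos.ne'⟩
  have hK0 : (K : ZMod n) = 0 := (ZMod.natCast_eq_zero_iff _ _).2 hK
  have h1 : ∀ w : ZMod n, ∑ v ∈ Finset.Ico (-K : ℤ) K, F v * ind w (v * d) =
      ∑ a ∈ Finset.range K, (c + if 2 ∣ K ∧ ¬ 2 ∣ a then σ else 0) * ind w (0 + a * d) := by
    intro w
    rw [sum_Ico_neg_eq]
    refine Finset.sum_congr rfl fun a ha => ?_
    have h2 := hF a (by omega) (by have := Finset.mem_range.1 ha; omega)
    have h3 : (2 ∣ K ∧ ¬ (2 : ℤ) ∣ (a : ℤ)) ↔ (2 ∣ K ∧ ¬ 2 ∣ a) := by omega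
    simp only [h3] at h2
    rw [← h2]
    push_cast
    rw [hK0]
    simp only [sub_zero, zero_add]
    ring
  simp only [h1, add_mul, Finset.sum_add_distrib, ← Finset.mul_sum]
  refine ((isConst_arith hd 0 hK).const_mul c).add ?_
  by_cases h2 : 2 ∣ K
  · obtain ⟨L, rfl⟩ := h2
    -- The odd arguments form a progression of difference `2 * d` and length `K / 2`, still a
    -- multiple of the odd number `n`.
    have hL : n ∣ L := (Nat.coprime_two_right.2 hn).dvd_of_dvd_mul_left hK
    have h4 : ∀ w : ZMod n, ∑ a ∈ Finset.range (2 * L),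
        (if 2 ∣ 2 * L ∧ ¬ 2 ∣ a then σ else 0) * ind w (0 + a * d) =
        σ * ∑ b ∈ Finset.range L, ind w (d + b * (2 * d)) := by
      intro w
      rw [sum_range_two_mul, Finset.mul_sum]
      refine Finset.sum_congr rfl fun b _ => ?_
      rw [if_neg (by omega), if_pos (by omega)]
      push_cast
      rw [zero_mul, zero_add]
      congr 2
      ring
    simp only [h4]
    exact (isConst_arith (isUnit_two_mul hn hd) d hL).const_mul σ
  · simp only [h2, false_and, if_false, zero_mul, Finset.sum_const_zero]
    exact fun _ _ => rfl

/-- In this range every outer occurrence has been counted, about `3|v| / 2` of them, and the inner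
ones compensate exactly up to parity. -/
lemma triMult_one_of_le {k : ℕ} {v : ℤ} (hv : 3 * |v| ≤ k) :
    triMult 1 k v = (k + 1) / 2 + if 2 ∣ k ∧ ¬ 2 ∣ v then 1 else 0 := by
  have hp : (2 : ℤ) ∣ v ↔ (2 : ℤ) ∣ |v| := (dvd_abs 2 v).symm
  have h0 := abs_nonneg v
  unfold triMult
  simp only [hp]
  rw [min_eq_left (by omega), max_eq_right (by omega), max_eq_right (by omega)]
  split_ifs <;> omega

lemma triMult_one_of_lt {k : ℕ} {v : ℤ} (hv : k < 3 * |v|) :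
    triMult 1 k v = max 0 (k - 3 * |v| / 2) := by
  unfold triMult
  rw [min_eq_right (by omega), max_eq_left (b := (_ / 2 : ℤ)) (by omega)]
  norm_num

lemma triMult_two_of_le {k : ℕ} {v : ℤ} (hv : 3 * |v| ≤ k) :
    triMult 2 k v = (k + 1) / 2 - if ¬ 2 ∣ k ∧ ¬ 2 ∣ v then 1 else 0 := by
  have hp : (2 : ℤ) ∣ v ↔ (2 : ℤ) ∣ |v| := (dvd_abs 2 v).symm
  have h0 := abs_nonneg v
  unfold triMult
  simp only [hp]
  rw [min_eq_left (by omega), max_eq_right (by omega), max_eq_right (by omega)]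
  split_ifs <;> omega

lemma triMult_two_of_lt {k : ℕ} {v : ℤ} (hv : k < 3 * |v|) :
    triMult 2 k v = max 0 (k + 1 - (3 * |v| + 1) / 2) := by
  unfold triMult
  rw [min_eq_right (by omega), max_eq_left (b := (_ / 2 : ℤ)) (by omega)]
  omega

/-- If `v` or `v - k` lies in the flat range, the other has weight 0. Otherwise both lie on the
slopes, whose sum is `2k - 3k/2 = k/2` up to rounding. -/
lemma triMult_one_fold {k : ℕ} {v : ℤ} (h0 : 0 ≤ v) (hv : v < k) :
    triMult 1 k v + triMult 1 k (v - k) = (k + 1) / 2 + if 2 ∣ k ∧ ¬ 2 ∣ v then 1 else 0 := by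
  have a1 : |v| = v := abs_of_nonneg h0
  have a2 : |v - k| = k - v := by rw [abs_of_neg (by omega)]; ring
  rcases le_or_gt (3 * |v|) k with h1 | h1
  · rw [triMult_one_of_le h1, triMult_one_of_lt (by omega), a2, max_eq_left (by omega), add_zero]
  rw [triMult_one_of_lt h1]
  rcases le_or_gt (3 * |v - k|) k with h2 | h2
  · have hp : (2 ∣ k ∧ ¬ (2 : ℤ) ∣ v - k) ↔ (2 ∣ k ∧ ¬ (2 : ℤ) ∣ v) := by omega
    rw [triMult_one_of_le h2, a1, max_eq_left (by omega), zero_add]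
    simp only [hp]
  · rw [triMult_one_of_lt h2, a1, a2, max_eq_right (by omega), max_eq_right (by omega)]
    split_ifs <;> omega

lemma triMult_two_fold {k : ℕ} {v : ℤ} (h0 : 0 ≤ v) (hv : v < k + 1) :
    triMult 2 k v + triMult 2 k (v - (k + 1)) =
      (k + 1) / 2 + if 2 ∣ k + 1 ∧ ¬ 2 ∣ v then -1 else 0 := by
  have a1 : |v| = v := abs_of_nonneg h0
  have a2 : |v - (k + 1)| = k + 1 - v := by rw [abs_of_neg (by omega)]; ring
  rcases le_or_gt (3 * |v|) k with h1 | h1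
  · rw [triMult_two_of_le h1, triMult_two_of_lt (by omega), a2, max_eq_left (by omega)]
    split_ifs <;> omega
  rw [triMult_two_of_lt h1]
  rcases le_or_gt (3 * |v - (k + 1)|) k with h2 | h2
  · rw [triMult_two_of_le h2, a1, max_eq_left (by omega)]
    split_ifs <;> omega
  · rw [triMult_two_of_lt h2, a1, a2, max_eq_right (by omega), max_eq_right (by omega)]
    split_ifs <;> omega

/-! ### Balanced triangles and rows -/

lemma isConst_triCount_one_of_dvd {n : ℕ} (hn : Odd n) {d : ZMod n} (hd : IsUnit d) {k : ℕ}
    (hk : n ∣ k) : IsConst (triCount d 1 k) := by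
  have h : triCount d 1 k = _ :=
    funext fun w => triCount_eq_sum_triMult d (Or.inl rfl) k k (by omega) w
  rw [h]
  exact isConst_of_fold hn hd hk _ ((k + 1) / 2) 1 fun v h0 hv => triMult_one_fold h0 hv

lemma isConst_triCount_two_of_dvd {n : ℕ} (hn : Odd n) {d : ZMod n} (hd : IsUnit d) {k : ℕ}
    (hk : n ∣ k + 1) : IsConst (triCount d 2 k) := by
  have h : triCount d 2 k = _ :=
    funext fun w => triCount_eq_sum_triMult d (Or.inr rfl) k (k + 1) (by push_cast; omega) w
  rw [h]
  refine isConst_of_fold hn hd hk _ ((k + 1) / 2) (-1) fun v h0 hv => ?_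
  push_cast at hv ⊢
  exact triMult_two_fold h0 hv

/-- Modulo `k + 1`, the rows of length `k + 1` of both families agree. -/
lemma rowMult_fold {k : ℕ} {v : ℤ} (h0 : 0 ≤ v) (hv : v < k + 1) :
    rowMult 2 k v + rowMult 2 k (v - (k + 1)) = rowMult 1 k v + rowMult 1 k (v - (k + 1)) := by
  have a1 : |v| = v := abs_of_nonneg h0
  have a2 : |v - (k + 1)| = k + 1 - v := by rw [abs_of_neg (by omega)]; ring
  unfold rowMult
  -- The inner terms do not involve `e`. For the outer ones, `x ↦ 3(k + 1) - x` carries `[k + 2, 2k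
  -- + 2]` onto `[k + 1, 2k + 1]`.
  rw [a1, a2, add_add_add_comm, eq_comm, add_add_add_comm]
  congr 1
  split_ifs <;> omega

/-- The longest row of the first triangle can be replaced by the row of the same length in the
second family; both resulting triangles have `k` or `k + 1` rows and are balanced. -/
lemma isConst_triCount_add {n : ℕ} (hn : Odd n) {d : ZMod n} (hd : IsUnit d) {k : ℕ}
    (hk : n ∣ k + 1) : IsConst fun w => triCount d 2 (k + 1) w + triCount d 1 k w := by
  have h : ∀ w, rowCount d 2 k w = rowCount d 1 k w := by
    intro w
    have hK : ((k + 1 : ℕ) : ZMod n) = 0 := (ZMod.natCast_eq_zero_iff _ _).2 hk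
    rw [rowCount_eq_sum_rowMult d (Or.inr rfl) k (k + 1) (by push_cast; omega),
      rowCount_eq_sum_rowMult d (Or.inl rfl) k (k + 1) (by push_cast; omega),
      sum_Ico_neg_eq, sum_Ico_neg_eq]
    refine Finset.sum_congr rfl fun a ha => ?_
    have h1 := rowMult_fold (k := k) (v := a) (by omega)
      (by have := Finset.mem_range.1 ha; omega)
    have h2 : (((a : ℤ) - (k + 1 : ℕ) : ℤ) : ZMod n) = ((a : ℤ) : ZMod n) := by
      rw [Int.cast_sub, Int.cast_natCast (k + 1), hK, sub_zero]
    rw [h2, ← add_mul, ← add_mul]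
    push_cast
    rw [h1]
  have h' : (fun w => triCount d 2 (k + 1) w + triCount d 1 k w) =
      fun w => triCount d 2 k w + triCount d 1 (k + 1) w := by
    funext w
    simp only [triCount, Finset.sum_range_succ, h]
    ring
  rw [h']
  exact (isConst_triCount_two_of_dvd hn hd hk).add (isConst_triCount_one_of_dvd hn hd hk)

/-- Rows whose length is a multiple of `3n` are unions of three balanced arithmetic
progressions. -/
lemma isConst_rowCount {n : ℕ} (hn : Odd n) {d : ZMod n} (hd : IsUnit d) {e : ℤ}
    (he : e = 1 ∨ e = 2) {L t : ℕ} (hL : n ∣ L) (ht : t + 1 = 3 * L) :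
    IsConst (rowCount d e t) := by
  have : NeZero n := ⟨hn.pos.ne'⟩
  have h : ∀ w, rowCount d e t w =
      ∑ b ∈ Finset.range L, ind w ((L + e - 1 : ℤ) * d + b * d) +
      ∑ b ∈ Finset.range L, ind w ((L - 1 : ℤ) * d + b * (-(2 * d))) +
      ∑ b ∈ Finset.range L, ind w ((2 - 2 * L - e : ℤ) * d + b * d) := by
    intro w
    rw [rowCount, ht, sum_range_three_mul, ← Finset.sum_add_distrib, ← Finset.sum_add_distrib]
    refine Finset.sum_congr rfl fun b _ => ?_
    -- The two values of `e` interchange the forms selected at `s ≡ 0` and `s ≡ 2` modulo 3; `id`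
    -- keeps `he` available.
    rcases id he with rfl | rfl
    · have e0 : triCoeff 1 t (3 * b : ℕ) = L + 1 - 1 + b := by
        have := triCoeff_spec he t (3 * b : ℕ); push_cast at *; omega
      have e1 : triCoeff 1 t (3 * b + 1 : ℕ) = L - 1 - 2 * b := by
        have := triCoeff_spec he t (3 * b + 1 : ℕ); push_cast at *; omega
      have e2 : triCoeff 1 t (3 * b + 2 : ℕ) = 2 - 2 * L - 1 + b := by
        have := triCoeff_spec he t (3 * b + 2 : ℕ); push_cast at *; omega
      rw [e0, e1, e2]
      push_cast
      ring_nf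
    · have e0 : triCoeff 2 t (3 * b : ℕ) = 2 - 2 * L - 2 + b := by
        have := triCoeff_spec he t (3 * b : ℕ); push_cast at *; omega
      have e1 : triCoeff 2 t (3 * b + 1 : ℕ) = L - 1 - 2 * b := by
        have := triCoeff_spec he t (3 * b + 1 : ℕ); push_cast at *; omega
      have e2 : triCoeff 2 t (3 * b + 2 : ℕ) = L + 2 - 1 + b := by
        have := triCoeff_spec he t (3 * b + 2 : ℕ); push_cast at *; omega
      rw [e0, e1, e2]
      push_cast
      ring_nf
  have h' : rowCount d e t = _ := funext h
  rw [h']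
  exact ((isConst_arith hd _ hL).add (isConst_arith (isUnit_two_mul hn hd).neg _ hL)).add
    (isConst_arith hd _ hL)

lemma isConst_triCount_one {n : ℕ} (hn : Odd n) {d : ZMod n} (hd : IsUnit d) {k : ℕ}
    (hk : (n : ℤ) ∣ k ∨ (3 * n : ℤ) ∣ k + 1) : IsConst (triCount d 1 k) := by
  rcases hk with hk | ⟨c, hc⟩
  · exact isConst_triCount_one_of_dvd hn hd (by exact_mod_cast hk)
  · obtain ⟨L, hL⟩ : ∃ L : ℕ, k + 1 = 3 * L := ⟨(k + 1) / 3, by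
      have : (3 : ℤ) ∣ k + 1 := ⟨n * c, by rw [hc, mul_assoc]⟩
      omega⟩
    have hnL : n ∣ L := by
      have : (L : ℤ) = n * c := by
        have : (3 : ℤ) * L = 3 * (n * c) := by
          rw [← mul_assoc, ← hc]
          exact_mod_cast hL.symm
        linarith
      exact_mod_cast Dvd.intro c this.symm
    -- The triangle with `k + 1` rows is balanced, and so is its longest row, of length `3L`.
    have h : triCount d 1 k = fun w => triCount d 1 (k + 1) w - rowCount d 1 k w := by
      funext w
      simp only [triCount, Finset.sum_range_succ, add_sub_cancel_right]
    rw [h]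
    exact (isConst_triCount_one_of_dvd hn hd (hL ▸ hnL.mul_left 3)).sub
      (isConst_rowCount hn hd (Or.inl rfl) hnL hL)

lemma isConst_triCount_two {n : ℕ} (hn : Odd n) {d : ZMod n} (hd : IsUnit d) {k : ℕ}
    (hk : (n : ℤ) ∣ k + 1 ∨ (3 * n : ℤ) ∣ k) : IsConst (triCount d 2 k) := by
  rcases hk with hk | ⟨c, hc⟩
  · exact isConst_triCount_two_of_dvd hn hd (by exact_mod_cast hk)
  · rcases k with _ | k
    · exact fun _ _ => by simp [triCount]
    · obtain ⟨L, hL⟩ : ∃ L : ℕ, k + 1 = 3 * L := ⟨(k + 1) / 3, by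
        have : (3 : ℤ) ∣ (k + 1 : ℕ) := ⟨n * c, by rw [hc, mul_assoc]⟩
        omega⟩
      have hnL : n ∣ L := by
        have : (L : ℤ) = n * c := by
          have : (3 : ℤ) * L = 3 * (n * c) := by
            rw [← mul_assoc, ← hc]
            exact_mod_cast hL.symm
          linarith
        exact_mod_cast Dvd.intro c this.symm
      have h : triCount d 2 (k + 1) = fun w => triCount d 2 k w + rowCount d 2 k w := by
        funext w
        simp only [triCount, Finset.sum_range_succ]
      rw [h]
      exact (isConst_triCount_two_of_dvd hn hd (hL ▸ hnL.mul_left 3)).add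
        (isConst_rowCount hn hd (Or.inr rfl) hnL hL)

/-! ### The figures as sums of row counts -/

lemma count_sum {ι : Type*} {n : ℕ} (w : ZMod n) (s : Finset ι) (f : ι → Multiset (ZMod n)) :
    (((∑ i ∈ s, f i).count w : ℕ) : ℤ) = ∑ i ∈ s, (((f i).count w : ℕ) : ℤ) := by
  rw [Multiset.count_sum', Nat.cast_sum]

lemma length_segment {R : Type*} (T : ℤ → R) (u v : ℤ) :
    (segment T u v).length = (v - u + 1).toNat := by
  simp [segment]

/-- A trapezoid whose rows are, up to sign and modulo `n`, the `h` first rows of a reversed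
triangle of height `m`. -/
lemma count_steinhausTrapezoid {n : ℕ} (d : ZMod n) {m h : ℕ} (hh : h ≤ m) (i₀ : ℕ) (u v : ℤ)
    (huv : v - u + 1 = m) (M : ℤ) (hM : (n : ℤ) ∣ M)
    (hc : ∀ t s : ℕ, s ≤ t → t < m →
      ∃ c, orbitCoeff (i₀ + (m - 1 - t) : ℤ) (u + s) = triCoeff 1 t s + c * M) (w : ZMod n) :
    (((steinhausTrapezoid (segment (seqDeriv^[i₀] (universalSeq d)) u v) h).count w : ℕ) : ℤ)
      = triCount d 1 m w - triCount d 1 (m - h) w := by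
  -- Rows shorten downwards: the trapezoid keeps the lengths `m - h + 1, …, m`, and the missing rows
  -- form the triangle of height `m - h`.
  rw [steinhausTrapezoid, count_sum, triCount, triCount,
    ← Finset.sum_range_add_sum_Ico _ (Nat.sub_le m h), add_sub_cancel_left,
    Finset.sum_Ico_eq_sum_range, Nat.sub_sub_self hh, ← Finset.sum_range_reflect]
  refine Finset.sum_congr rfl fun i hi => ?_
  have hi' := Finset.mem_range.1 hi
  rw [finDeriv_iterate_segment, ← Function.iterate_add_apply]
  refine count_segment_orbit d (Or.inl rfl) _ _ _ _ (by omega) M hM (fun s hs => ?_) w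
  obtain ⟨c, h1⟩ := hc (m - h + i) s hs (by omega)
  refine ⟨c, ?_⟩
  rw [← h1]
  congr 1
  omega

lemma steinhausTriangle_segment {R : Type*} [Add R] (T : ℤ → R) (u v : ℤ) :
    steinhausTriangle (segment T u v)
      = steinhausTrapezoid (segment T u v) (v - u + 1).toNat := by
  rw [steinhausTriangle, length_segment, steinhausTrapezoid]

lemma drop_take_segment {R : Type*} (T : ℤ → R) (u v : ℤ) (a b : ℕ)
    (hab : (a : ℤ) + b ≤ v - u + 1) :
    ((segment T u v).drop a).take b = segment T (u + a) (u + a + b - 1) := by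
  apply List.ext_getElem
  · simp only [List.length_take, List.length_drop, length_segment]
    omega
  · intro p h1 h2
    simp only [segment, List.getElem_take, List.getElem_drop, List.getElem_map,
      List.getElem_range]
    push_cast
    rw [add_assoc]

lemma count_pascalRow {n : ℕ} (d : ZMod n) {m i : ℕ} (hi : i < m) (w : ZMod n) :
    (((pascalRow m (segment (seqDeriv (universalSeq d)) (-m) (m - 2)) i :
      Multiset (ZMod n)).count w : ℕ) : ℤ) = rowCount d 2 i w := by
  rw [pascalRow, finDeriv_iterate_segment, ← Function.iterate_succ_apply,
    drop_take_segment _ _ _ _ _ (by push_cast; omega)]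
  -- Here the coefficients agree as integers, so the modulus 0 suffices and `m` is unrestricted.
  refine count_segment_orbit d (Or.inr rfl) _ _ _ _ (by push_cast; omega) 0 (dvd_zero _)
    (fun s hs => ⟨0, ?_⟩) w
  have h1 := triCoeff_spec (Or.inr rfl) i s
  have h2 := orbitCoeff_spec (i.succ : ℕ) (-m + (m - 1 - i : ℕ) + s)
  rw [zero_mul, add_zero]
  push_cast at h2 ⊢
  rcases h1 with h1 | h1 | h1 <;> rcases h2 with h2 | h2 | h2 <;> omega

lemma count_pascalTriangle {n : ℕ} (d : ZMod n) (m : ℕ) (w : ZMod n) :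
    (((pascalTriangle m (segment (seqDeriv (universalSeq d)) (-m) (m - 2))).count w : ℕ) : ℤ)
      = triCount d 2 m w := by
  rw [pascalTriangle, count_sum]
  exact Finset.sum_congr rfl fun i hi => count_pascalRow d (Finset.mem_range.1 hi) w

lemma count_pascalTrapezoid {n : ℕ} (d : ZMod n) (m h : ℕ) (w : ZMod n) :
    (((pascalTrapezoid m (segment (seqDeriv (universalSeq d)) (-m) (m - 2)) h).count w : ℕ) : ℤ)
      = triCount d 2 m w - triCount d 2 (m - h) w := by
  rw [pascalTrapezoid, count_sum, triCount, triCount,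
    ← Finset.sum_range_add_sum_Ico _ (Nat.sub_le m h), add_sub_cancel_left]
  exact Finset.sum_congr rfl fun i hi => count_pascalRow d (Finset.mem_Ico.1 hi).2 w

lemma count_steinhausTrapezoid_left {n : ℕ} (d : ZMod n) {m h : ℕ} (hh : h ≤ m)
    (hm : (n : ℤ) ∣ m) (w : ZMod n) :
    (((steinhausTrapezoid (segment (universalSeq d) m (2 * m - 1)) h).count w : ℕ) : ℤ)
      = triCount d 1 m w - triCount d 1 (m - h) w := by
  refine count_steinhausTrapezoid d hh 0 _ _ (by ring) m hm (fun t s hs ht => ?_) w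
  have h1 := triCoeff_spec (Or.inl rfl) t s
  have h2 := orbitCoeff_spec ((0 : ℕ) + (m - 1 - t)) (m + s)
  push_cast at h2 ⊢
  -- The three forms are shifted by `0`, `-3m` and `3m`.
  rcases h2 with h2 | h2 | h2
  · exact ⟨0, by omega⟩
  · exact ⟨-1, by omega⟩
  · exact ⟨1, by omega⟩

lemma count_steinhausTrapezoid_deriv {n : ℕ} (d : ZMod n) {m h : ℕ} (hh : h ≤ m)
    (hm : (3 * n : ℤ) ∣ m + 1) (w : ZMod n) :
    (((steinhausTrapezoid (segment (seqDeriv (universalSeq d)) 0 (m - 1)) h).count w : ℕ) : ℤ)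
      = triCount d 1 m w - triCount d 1 (m - h) w := by
  obtain ⟨c, hc⟩ := hm
  rw [mul_assoc] at hc
  refine count_steinhausTrapezoid d hh 1 _ _ (by ring) (n * c) (dvd_mul_right _ _)
    (fun t s hs ht => ?_) w
  have h1 := triCoeff_spec (Or.inl rfl) t s
  have h2 := orbitCoeff_spec ((1 : ℕ) + (m - 1 - t)) (0 + s)
  generalize (n : ℤ) * c = M at *
  push_cast at h2 ⊢
  -- The shifts are `-(m + 1)`, `-(m + 1)` and `2(m + 1)`; a third of `m + 1` must vanish modulo
  -- `n`, whence the modulus `3n`.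
  rcases h2 with h2 | h2 | h2
  · exact ⟨-1, by omega⟩
  · exact ⟨-1, by omega⟩
  · exact ⟨2, by omega⟩

lemma count_lozenge {n : ℕ} (d : ZMod n) {m : ℕ} (h0 : 0 < m) (hm : (n : ℤ) ∣ m) (w : ZMod n) :
    (((lozenge m (segment (seqDeriv (universalSeq d)) (-m) (m - 2))).count w : ℕ) : ℤ)
      = triCount d 2 m w + triCount d 1 (m - 1) w := by
  rw [lozenge, Multiset.count_add, Nat.cast_add, count_pascalTriangle]
  congr 1
  rw [finDeriv_iterate_segment, steinhausTriangle_segment, ← Function.iterate_succ_apply,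
    count_steinhausTrapezoid d (m := m - 1) (by omega) _ _ _ (by omega) m hm]
  · rw [show m - 1 - _ = 0 by omega]
    simp [triCount]
  · intro t s hs ht
    have h1 := triCoeff_spec (Or.inl rfl) t s
    have h2 := orbitCoeff_spec (m.succ + ((m - 1 : ℕ) - 1 - t)) (-m + s)
    push_cast at h2 ⊢
    rcases h2 with h2 | h2 | h2
    · exact ⟨-1, by omega⟩
    · exact ⟨0, by omega⟩
    · exact ⟨1, by omega⟩

end Steinhaus

theorem mainTheorem1 (n : ℕ) (hn : Odd n) (d : ZMod n) (hd : IsUnit d)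
    (S : ℤ → ZMod n) (hS : S = Steinhaus.universalSeq d) :
    -- Steinhaus triangles
    (∀ m : ℕ, 0 < m → (m : ℤ) ≡ 0 [ZMOD n] →
      Steinhaus.IsBalanced
        (Steinhaus.steinhausTriangle (Steinhaus.segment S m (2 * m - 1)))) ∧
    (∀ m : ℕ, 0 < m → (m : ℤ) ≡ -1 [ZMOD (3 * n)] →
      Steinhaus.IsBalanced
        (Steinhaus.steinhausTriangle
          (Steinhaus.segment (Steinhaus.seqDeriv S) 0 (m - 1)))) ∧
    -- Steinhaus trapezoids
    (∀ m h : ℕ, 0 < m → 0 < h → h ≤ m → (m : ℤ) ≡ 0 [ZMOD n] →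
      ((h : ℤ) ≡ 0 [ZMOD n] ∨ (h : ℤ) ≡ m + 1 [ZMOD (3 * n)]) →
      Steinhaus.IsBalanced
        (Steinhaus.steinhausTrapezoid (Steinhaus.segment S m (2 * m - 1)) h)) ∧
    (∀ m h : ℕ, 0 < m → 0 < h → h ≤ m → (m : ℤ) ≡ -1 [ZMOD (3 * n)] →
      ((h : ℤ) ≡ -1 [ZMOD n] ∨ (h : ℤ) ≡ 0 [ZMOD (3 * n)]) →
      Steinhaus.IsBalanced
        (Steinhaus.steinhausTrapezoid
          (Steinhaus.segment (Steinhaus.seqDeriv S) 0 (m - 1)) h)) ∧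
    -- Pascal triangles
    (∀ m : ℕ, 0 < m → ((m : ℤ) ≡ -1 [ZMOD n] ∨ (m : ℤ) ≡ 0 [ZMOD (3 * n)]) →
      Steinhaus.IsBalanced
        (Steinhaus.pascalTriangle m
          (Steinhaus.segment (Steinhaus.seqDeriv S) (-m) (m - 2)))) ∧
    -- Pascal trapezoids
    (∀ m h : ℕ, 0 < m → 0 < h → h ≤ m →
      ((m : ℤ) ≡ -1 [ZMOD n] ∨ (m : ℤ) ≡ 0 [ZMOD (3 * n)]) →
      ((h : ℤ) ≡ m + 1 [ZMOD n] ∨ (h : ℤ) ≡ m [ZMOD (3 * n)]) →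
      Steinhaus.IsBalanced
        (Steinhaus.pascalTrapezoid m
          (Steinhaus.segment (Steinhaus.seqDeriv S) (-m) (m - 2)) h)) ∧
    -- lozenges
    (∀ m : ℕ, 0 < m → (m : ℤ) ≡ 0 [ZMOD n] →
      Steinhaus.IsBalanced
        (Steinhaus.lozenge m
          (Steinhaus.segment (Steinhaus.seqDeriv S) (-m) (m - 2)))) := by
  subst hS
  have key : ∀ m h : ℕ, h ≤ m → ((m - h : ℕ) : ℤ) = m - h := fun m h hh => by omega
  have part3 : ∀ m h : ℕ, 0 < m → 0 < h → h ≤ m → (m : ℤ) ≡ 0 [ZMOD n] →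
      ((h : ℤ) ≡ 0 [ZMOD n] ∨ (h : ℤ) ≡ m + 1 [ZMOD (3 * n)]) →
      Steinhaus.IsBalanced (Steinhaus.steinhausTrapezoid
        (Steinhaus.segment (Steinhaus.universalSeq d) m (2 * m - 1)) h) := by
    intro m h _ _ hh hm hh'
    have hm' : (n : ℤ) ∣ m := Int.modEq_zero_iff_dvd.1 hm
    refine Steinhaus.isBalanced_of_count
      ((Steinhaus.isConst_triCount_one hn hd (Or.inl hm')).sub
        (Steinhaus.isConst_triCount_one (k := m - h) hn hd ?_))
      (Steinhaus.count_steinhausTrapezoid_left d hh hm')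
    -- The removed triangle has height `m - h`, which is `0` modulo `n` or `-1` modulo `3n`: the two
    -- balanced cases.
    rw [key m h hh]
    rcases hh' with h1 | h1
    · exact Or.inl (dvd_sub hm' (Int.modEq_zero_iff_dvd.1 h1))
    · refine Or.inr ?_
      have := h1.dvd
      rwa [show (m : ℤ) + 1 - h = m - h + 1 by ring] at this
  have part4 : ∀ m h : ℕ, 0 < m → 0 < h → h ≤ m → (m : ℤ) ≡ -1 [ZMOD (3 * n)] →
      ((h : ℤ) ≡ -1 [ZMOD n] ∨ (h : ℤ) ≡ 0 [ZMOD (3 * n)]) →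
      Steinhaus.IsBalanced (Steinhaus.steinhausTrapezoid
        (Steinhaus.segment (Steinhaus.seqDeriv (Steinhaus.universalSeq d)) 0 (m - 1)) h) := by
    intro m h _ _ hh hm hh'
    have hm' : (3 * n : ℤ) ∣ m + 1 := by simpa using hm.symm.dvd
    refine Steinhaus.isBalanced_of_count
      ((Steinhaus.isConst_triCount_one hn hd (Or.inr hm')).sub
        (Steinhaus.isConst_triCount_one (k := m - h) hn hd ?_))
      (Steinhaus.count_steinhausTrapezoid_deriv d hh hm')
    rw [key m h hh]
    rcases hh' with h1 | h1
    · left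
      have h2 : (n : ℤ) ∣ h + 1 := by simpa using h1.symm.dvd
      have := dvd_sub ((dvd_mul_left _ _).trans hm') h2
      rwa [add_sub_add_right_eq_sub] at this
    · right
      have := dvd_sub hm' (Int.modEq_zero_iff_dvd.1 h1)
      rwa [add_sub_right_comm] at this
  have pascal : ∀ m : ℕ, ((m : ℤ) ≡ -1 [ZMOD n] ∨ (m : ℤ) ≡ 0 [ZMOD (3 * n)]) →
      Steinhaus.IsConst (Steinhaus.triCount d 2 m) := fun m hm =>
    Steinhaus.isConst_triCount_two hn hd
      (hm.imp (fun h => by simpa using h.symm.dvd) Int.modEq_zero_iff_dvd.1)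
  refine ⟨fun m h0 hm => ?_, fun m h0 hm => ?_, part3, part4, fun m _ hm => ?_,
    fun m h _ _ hh hm hh' => ?_, fun m h0 hm => ?_⟩
  · rw [Steinhaus.steinhausTriangle_segment, show (2 * m - 1 - m + 1 : ℤ).toNat = m by omega]
    exact part3 m m h0 h0 le_rfl hm (Or.inl hm)
  · rw [Steinhaus.steinhausTriangle_segment, show (m - 1 - 0 + 1 : ℤ).toNat = m by omega]
    exact part4 m m h0 h0 le_rfl hm (Or.inl (hm.of_mul_left 3))
  · exact Steinhaus.isBalanced_of_count (pascal m hm) (Steinhaus.count_pascalTriangle d m)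
  · refine Steinhaus.isBalanced_of_count ((pascal m hm).sub (pascal (m - h) ?_))
      (Steinhaus.count_pascalTrapezoid d m h)
    rw [key m h hh]
    refine hh'.imp (fun h1 => ?_) fun h1 => ?_
    · have := (Int.ModEq.refl (m : ℤ)).sub h1
      rwa [sub_add_cancel_left] at this
    · have := (Int.ModEq.refl (m : ℤ)).sub h1
      rwa [sub_self] at this
  · have hm' : (n : ℤ) ∣ m := Int.modEq_zero_iff_dvd.1 hm
    obtain ⟨k, rfl⟩ : ∃ k, m = k + 1 := ⟨m - 1, by omega⟩
    exact Steinhaus.isBalanced_of_count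
      (Steinhaus.isConst_triCount_add hn hd (by exact_mod_cast hm'))
      (Steinhaus.count_lozenge d h0 hm')
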